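/- Let $n,m,w,t$ be non-negative integers with $t\ge 1$, let $0\le\eta<1$, $0\le\delta<1$ and $\gamma\ge 0$, where $\gamma>0$ if $\eta>0$. A weighted function $g:\{-1,1\}^S\to[0,\infty)$, $S\subseteq\{1,\dots,n\}$, is called contractive with gap $1-\eta$ if $g\le 1$ everywhere, $\max g=1$, and $g(x)\le\eta$ whenever $g(x)<1$; it has width $w$ if $|S|\le w$. Let $f(x)=\prod_{k=1}^m f_k(x_{S_k})$ on $\{-1,1\}^n$, where every $f_k:\{-1,1\}^{S_k}\to[0,\infty)$ is contractive with gap $1-\eta$ and has width $w$. Let $J|z$ be a $\delta$-random restriction: $J\subseteq\{1,\dots,n\}$ contains each index independently with probability $\delta$ and, given $J$, $z$ is uniform on $\{-1,1\}^{\overline J}$, where $\overline J=\{1,\dots,n\}\setminus J$. Let $f_{J|z}:\{-1,1\}^J\to\mathbb R$ be the function obtained from $f$ by fixing the variables outside $J$ to $z$. Then $$\Pr\Big(\exists\text{ a decision tree } h \text{ on the variables in } J \text{ of depth at most } t \text{ with } \max_y|h(y)-f_{J|z}(y)|\le\gamma\Big)\ \ge\ 1-\frac12\Big(\frac{\delta}{1-\delta}\,8uw\Big)^t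 .$$ Here $u=1$ if $\eta=0$, and $u=\max(\lceil\log_\eta\gamma\rceil,0)+1$ if $\eta>0$ (so $u=\lceil\log_\eta\gamma\rceil+1$ when $\gamma\le 1$). A decision tree is a binary tree whose inner nodes are labelled with variables, with outgoing edges $-1$ and $1$, and whose leaves carry real values; its depth is the length of a longest root-to-leaf path. -/

import Mathlib

/-- `g` is a contractive weighted function with gap `1 - η`: it is non-negative, bounded by `1`,
its maximum is `1`, and every value below `1` is at most `η`.  Assignments take values in
`ℤˣ = {-1, 1}`. -/
def IsContractive {V : Type} (η : ℝ) (g : (V → ℤˣ) → ℝ) : Prop :=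
  (∀ x, 0 ≤ g x) ∧ (∀ x, g x ≤ 1) ∧ IsGreatest (Set.range g) 1 ∧ ∀ x, g x < 1 → g x ≤ η

/-- A decision tree over the variables `V`, with real leaf labels.  In `node v a b` the edge
labelled `-1` leads to `a` and the edge labelled `1` leads to `b`. -/
inductive DecisionTree (V : Type) : Type
  | leaf (c : ℝ) : DecisionTree V
  | node (v : V) (a b : DecisionTree V) : DecisionTree V

namespace DecisionTree

/-- The function computed by a decision tree. -/
def eval {V : Type} : DecisionTree V → (V → ℤˣ) → ℝ
  | leaf c, _ => c
  | node v a b, x => if x v = -1 then a.eval x else b.eval x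

/-- Length of the longest path from the root to a leaf (number of queries on it). -/
def depth {V : Type} : DecisionTree V → ℕ
  | leaf _ => 0
  | node _ a b => max a.depth b.depth + 1

end DecisionTree

/-- A restriction `J|z`: the set `J` of variables left free, and an assignment `z` of the
remaining ones. -/
abbrev Restriction (n : ℕ) : Type :=
  (J : Finset (Fin n)) × ({i : Fin n // i ∉ J} → ℤˣ)

/-- The restricted function `f_{J|z} : {-1,1}^J → ℝ`. -/
def restrict {n : ℕ} (f : (Fin n → ℤˣ) → ℝ) (ρ : Restriction n) :
    ({i : Fin n // i ∈ ρ.1} → ℤˣ) → ℝ :=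
  fun y => f (fun i => if h : i ∈ ρ.1 then y ⟨i, h⟩ else ρ.2 ⟨i, h⟩)

/-- The law of a random subset of `Fin n` that contains each element independently with
probability `δ`. -/
noncomputable def randomSubset (n : ℕ) (δ : ℝ) (h0 : 0 ≤ δ) (h1 : δ ≤ 1) :
    PMF (Finset (Fin n)) :=
  PMF.ofFintype
    (fun J => ENNReal.ofReal δ ^ J.card * ENNReal.ofReal (1 - δ) ^ (n - J.card)) (by
      have h := Fintype.sum_pow_mul_eq_add_pow (Fin n) (ENNReal.ofReal δ) (ENNReal.ofReal (1 - δ))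
      rw [Fintype.card_fin] at h
      rw [h, ← ENNReal.ofReal_add h0 (sub_nonneg.2 h1)]
      simp)

/-- The law of a `δ`-random restriction `J|z`: first `J` is drawn, then `z` is drawn uniformly
among the assignments of the variables outside `J`. -/
noncomputable def randomRestriction (n : ℕ) (δ : ℝ) (h0 : 0 ≤ δ) (h1 : δ ≤ 1) :
    PMF (Restriction n) :=
  (randomSubset n δ h0 h1).bind fun J =>
    (PMF.uniformOfFintype ({i : Fin n // i ∉ J} → ℤˣ)).map fun z => ⟨J, z⟩

/-- `u = 1` if `η = 0`, and `u = ⌈log_η γ⌉ + 1` if `0 < η < 1`.  For `0 < γ ≤ 1` the logarithm is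
non-negative; for `γ > 1` the natural-number ceiling of the negative logarithm is `0`. -/
noncomputable def switchingU (η γ : ℝ) : ℕ :=
  if η = 0 then 1 else ⌈Real.logb η γ⌉₊ + 1

/-! Razborov-style encoding of bad restrictions. The canonical tree queries the free variables of
the first factor that is not constant under the current restriction, then repeats. Factors passed
over are constant, and once `u` of them are below 1 the product is at most `η ^ u ≤ γ`, so the leaf
0 suffices. Hence a restriction `ρ` without a good tree of depth `t` has a path of `t` queries that
skips fewer than `u` live factors each time (`exists_trace`).

Such a path sends `ρ` to an assignment `τ` fixing `t` more variables, not to the answers on the path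
but to values keeping each opened factor below 1. This costs a factor `2δ/(1-δ)` per query
(`Trace.weight_eq`).

Given the code of the path, `τ` determines `ρ` (`Trace.injective`): the opened factor is still live
under `τ` and the constant factors before it are unaffected, so the number of skipped live factors
identifies it; the recorded position and answer then undo one query. Since the weights of all `τ`
sum to 1, each code accounts for bad weight at most `(2δ/(1-δ)) ^ t`, and it remains to count codes.
-/

/-- A partial assignment to the variables `V`; `none` marks a free variable. -/
abbrev PartialAssignment (V : Type) : Type := V → Option ℤˣ

/-! ### Partial assignments and their weights. -/

namespace PartialAssignment

variable {V : Type}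

/-- The total assignment `x` agrees with `ρ` wherever `ρ` is defined. -/
def Completes (x : V → ℤˣ) (ρ : PartialAssignment V) : Prop :=
  ∀ i b, ρ i = some b → x i = b

/-- `τ` fixes every variable that `ρ` fixes, to the same value. -/
def Refines (τ ρ : PartialAssignment V) : Prop :=
  ∀ i b, ρ i = some b → τ i = some b

/-- Fill the free variables of `ρ` from `y`. -/
def fill (ρ : PartialAssignment V) (y : V → ℤˣ) : V → ℤˣ := fun i => (ρ i).getD (y i)

lemma completes_fill (ρ : PartialAssignment V) (y : V → ℤˣ) : Completes (ρ.fill y) ρ := by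
  intro i b h
  simp [fill, h]

lemma Completes.of_refines {x : V → ℤˣ} {ρ τ : PartialAssignment V} (hx : Completes x τ)
    (h : Refines τ ρ) : Completes x ρ :=
  fun i b hb => hx i b (h i b hb)

lemma refines_of_update [DecidableEq V] {ρ τ : PartialAssignment V} {v : V} {π : ℤˣ} (b : ℤˣ)
    (hv : ρ v = none) (h : Refines τ (Function.update ρ v (some π))) :
    Refines (Function.update τ v (some b)) ρ := by
  intro i c hc
  have hi : i ≠ v := by
    rintro rfl
    simp [hv] at hc
  rw [Function.update_of_ne hi]
  exact h i c (by rwa [Function.update_of_ne hi])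

lemma Completes.update [DecidableEq V] {x : V → ℤˣ} {ρ : PartialAssignment V}
    (h : Completes x ρ) (v : V) : Completes x (Function.update ρ v (some (x v))) := by
  intro i b hb
  by_cases hi : i = v
  · subst hi
    simpa using hb
  · exact h i b (by rwa [Function.update_of_ne hi] at hb)

/-- The probability of `ρ` when each variable is independently free with probability `δ` and
otherwise uniform. -/
noncomputable def weight [Fintype V] (δ : ℝ) (ρ : PartialAssignment V) : ℝ :=
  ∏ i, if ρ i = none then δ else (1 - δ) / 2

lemma weight_nonneg [Fintype V] {δ : ℝ} (h0 : 0 ≤ δ) (h1 : δ ≤ 1) (ρ : PartialAssignment V) :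
    0 ≤ ρ.weight δ := by
  refine Finset.prod_nonneg fun i _ => ?_
  split_ifs
  · exact h0
  · linarith

lemma sum_weight [Fintype V] [DecidableEq V] (δ : ℝ) :
    ∑ ρ : PartialAssignment V, ρ.weight δ = 1 := by
  have h := Finset.prod_univ_sum (fun _ : V => (Finset.univ : Finset (Option ℤˣ)))
    (fun _ o => if o = none then δ else (1 - δ) / 2)
  rw [Fintype.piFinset_univ] at h
  simp only [weight]
  rw [← h]
  refine Finset.prod_eq_one fun _ _ => ?_
  simp only [Fintype.sum_option, if_true, reduceCtorEq, if_false, Finset.sum_const,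
    Finset.card_univ, Fintype.card_units_int, nsmul_eq_mul]
  push_cast
  ring

/-- Fixing a free variable exchanges one factor `δ` for `(1 - δ) / 2`. -/
lemma weight_update_of_eq_none [Fintype V] [DecidableEq V] {δ : ℝ} (hδ : δ < 1)
    {ρ : PartialAssignment V} {v : V} (hv : ρ v = none) (b : ℤˣ) :
    ρ.weight δ = 2 * δ / (1 - δ) * weight δ (Function.update ρ v (some b)) := by
  have h1 : 1 - δ ≠ 0 := by linarith
  simp only [weight]
  rw [← Finset.mul_prod_erase _ _ (Finset.mem_univ v),
    ← Finset.mul_prod_erase _ (fun i => if Function.update ρ v (some b) i = none then δ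
      else (1 - δ) / 2) (Finset.mem_univ v)]
  have : ∏ i ∈ Finset.univ.erase v, (if Function.update ρ v (some b) i = none then δ
      else (1 - δ) / 2) = ∏ i ∈ Finset.univ.erase v, (if ρ i = none then δ else (1 - δ) / 2) :=
    Finset.prod_congr rfl fun i hi => by rw [Function.update_of_ne (Finset.ne_of_mem_erase hi)]
  rw [this]
  simp only [hv, Function.update_self, if_true, reduceCtorEq, if_false]
  field_simp

lemma weight_update_of_ne_none [Fintype V] [DecidableEq V] {δ : ℝ} {ρ : PartialAssignment V}
    {v : V} (hv : ρ v ≠ none) (b : ℤˣ) :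
    weight δ (Function.update ρ v (some b)) = ρ.weight δ := by
  refine Finset.prod_congr rfl fun i _ => ?_
  by_cases hi : i = v
  · subst hi
    simp [hv]
  · rw [Function.update_of_ne hi]

end PartialAssignment

/-! ### Live factors and paths of the canonical tree. -/

namespace Switching

open PartialAssignment

variable {V ι : Type}

/-- The restriction of `F` to `ρ` takes a value below `1`. -/
def Live (F : (V → ℤˣ) → ℝ) (ρ : PartialAssignment V) : Prop :=
  ∃ x, Completes x ρ ∧ F x < 1

/-- The restriction of `F` to `ρ` is constant. -/
def ConstOn (F : (V → ℤˣ) → ℝ) (ρ : PartialAssignment V) : Prop :=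
  ∀ x x', Completes x ρ → Completes x' ρ → F x = F x'

lemma ConstOn.live_iff {F : (V → ℤˣ) → ℝ} {ρ τ : PartialAssignment V} (h : ConstOn F ρ)
    (hτ : Refines τ ρ) : Live F τ ↔ Live F ρ := by
  constructor
  · rintro ⟨x, hx, hlt⟩
    exact ⟨x, hx.of_refines hτ, hlt⟩
  · rintro ⟨x, hx, hlt⟩
    have hc := completes_fill τ 1
    exact ⟨_, hc, h _ _ hx (hc.of_refines hτ) ▸ hlt⟩

open Classical in
/-- The number of functions before the `k`-th whose restriction to `ρ` is not identically `1`. -/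
noncomputable def liveBefore [Fintype ι] [LinearOrder ι] (F : ι → (V → ℤˣ) → ℝ) (k : ι)
    (ρ : PartialAssignment V) : ℕ :=
  (Finset.univ.filter fun k' => k' < k ∧ Live (F k') ρ).card

lemma liveBefore_lt [Fintype ι] [LinearOrder ι] {F : ι → (V → ℤˣ) → ℝ} {k k' : ι}
    {ρ : PartialAssignment V} (hlt : k < k') (hk : Live (F k) ρ) :
    liveBefore F k ρ < liveBefore F k' ρ := by
  classical
  refine Finset.card_lt_card ?_
  rw [Finset.ssubset_iff_of_subset]
  · exact ⟨k, by simp [hlt, hk], by simp⟩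
  · intro i hi
    simp only [Finset.mem_filter, Finset.mem_univ, true_and] at hi ⊢
    exact ⟨hi.1.trans hlt, hi.2⟩

lemma eq_of_liveBefore_eq [Fintype ι] [LinearOrder ι] {F : ι → (V → ℤˣ) → ℝ} {k k' : ι}
    {ρ : PartialAssignment V} (hk : Live (F k) ρ) (hk' : Live (F k') ρ)
    (h : liveBefore F k ρ = liveBefore F k' ρ) : k = k' := by
  rcases lt_trichotomy k k' with hlt | heq | hlt
  · exact absurd h (liveBefore_lt hlt hk).ne
  · exact heq
  · exact absurd h (liveBefore_lt hlt hk').ne'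

/-- Constant factors cannot change under refinement. This lets the decoder, who sees only the
endpoint, recount the factors skipped at the start. -/
lemma liveBefore_eq_of_refines [Fintype ι] [LinearOrder ι] {F : ι → (V → ℤˣ) → ℝ} {k : ι}
    {ρ τ : PartialAssignment V} (hc : ∀ k' < k, ConstOn (F k') ρ) (hτ : Refines τ ρ) :
    liveBefore F k τ = liveBefore F k ρ := by
  classical
  unfold liveBefore
  congr 1
  ext i
  simp only [Finset.mem_filter, Finset.mem_univ, true_and]
  exact and_congr_right fun hi => (hc i hi).live_iff hτ

/-- `F k` is the next function whose variables the canonical decision tree queries, `j` earlier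
functions are already below `1`, and `y` is a completion on which `F k` is below `1`. -/
structure Opens [Fintype ι] [LinearOrder ι] (F : ι → (V → ℤˣ) → ℝ) (ρ : PartialAssignment V)
    (k : ι) (y : V → ℤˣ) (j : ℕ) : Prop where
  const : ∀ k' < k, ConstOn (F k') ρ
  completes : Completes y ρ
  lt_one : F k y < 1
  count : liveBefore F k ρ = j

/-- `Trace F S idx ρ k y P L τ`: a path of the canonical decision tree from `ρ`, along which the
variables `P` of `S k` are still to be queried. The list `L` records, for each query, whether
it starts a new function (and how many live functions to skip), the position of the variable and
the answer; `τ` refines `ρ` by giving the queried variables the values that keep the functions of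
the path below `1`. -/
inductive Trace [DecidableEq V] [Fintype ι] [LinearOrder ι] (F : ι → (V → ℤˣ) → ℝ)
    (S : ι → Finset V) (idx : ι → V → ℕ) {u w : ℕ} :
    PartialAssignment V → ι → (V → ℤˣ) → Finset V → List (Option (Fin u) × Fin w × ℤˣ) →
      PartialAssignment V → Prop
  | nil (ρ : PartialAssignment V) (k : ι) (y : V → ℤˣ) (P : Finset V)
      (hP : ∀ i ∈ P, ρ i = none) : Trace F S idx ρ k y P [] ρ
  | query (ρ τ : PartialAssignment V) (k : ι) (y : V → ℤˣ) (P : Finset V) (v : V) (a : Fin w)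
      (π : ℤˣ) (L : List (Option (Fin u) × Fin w × ℤˣ)) (hvP : v ∈ P) (hvS : v ∈ S k)
      (hv : ρ v = none) (ha : idx k v = a)
      (h : Trace F S idx (Function.update ρ v (some π)) k y (P.erase v) L τ) :
      Trace F S idx ρ k y P ((none, a, π) :: L) (Function.update τ v (some (y v)))
  | start (ρ τ : PartialAssignment V) (k₀ : ι) (y₀ : V → ℤˣ) (k : ι) (y : V → ℤˣ) (v : V)
      (j : Fin u) (a : Fin w) (π : ℤˣ) (L : List (Option (Fin u) × Fin w × ℤˣ))
      (ho : Opens F ρ k y j) (hvS : v ∈ S k) (hv : ρ v = none) (ha : idx k v = a)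
      (h : Trace F S idx (Function.update ρ v (some π)) k y
        (((S k).filter fun i => ρ i = none).erase v) L τ) :
      Trace F S idx ρ k₀ y₀ ∅ ((some j, a, π) :: L) (Function.update τ v (some (y v)))

/-! ### Weight and decoding of traces. -/

section Trace

variable [DecidableEq V] [Fintype ι] [LinearOrder ι] {F : ι → (V → ℤˣ) → ℝ}
  {S : ι → Finset V} {idx : ι → V → ℕ} {u w : ℕ} {ρ τ : PartialAssignment V} {k : ι}
  {y : V → ℤˣ} {P : Finset V} {L : List (Option (Fin u) × Fin w × ℤˣ)}

lemma Trace.refines (h : Trace F S idx ρ k y P L τ) : Refines τ ρ := by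
  induction h with
  | nil => exact fun _ _ h => h
  | query ρ τ k y P v a π L hvP hvS hv ha h ih => exact refines_of_update _ hv ih
  | start ρ τ k₀ y₀ k y v j a π L ho hvS hv ha h ih => exact refines_of_update _ hv ih

/-- A path may stop in the middle of a factor, so pending variables can stay free; they never
contradict `y`, which is what keeps the factor live. -/
lemma Trace.eq_none_or (h : Trace F S idx ρ k y P L τ) :
    ∀ i ∈ P, τ i = none ∨ τ i = some (y i) := by
  induction h with
  | nil ρ k y P hP => exact fun i hi => Or.inl (hP i hi)
  | query ρ τ k y P v a π L hvP hvS hv ha h ih =>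
    intro i hi
    by_cases hiv : i = v
    · subst hiv
      simp
    · rw [Function.update_of_ne hiv]
      exact ih i (Finset.mem_erase.2 ⟨hiv, hi⟩)
  | start => simp

lemma Trace.weight_eq [Fintype V] {δ : ℝ} (hδ : δ < 1) (h : Trace F S idx ρ k y P L τ) :
    ρ.weight δ = (2 * δ / (1 - δ)) ^ L.length * τ.weight δ := by
  have step : ∀ {ρ τ : PartialAssignment V} {v : V} {π b : ℤˣ} {r : ℝ}, ρ v = none →
      Refines τ (Function.update ρ v (some π)) →
      weight δ (Function.update ρ v (some π)) = r * τ.weight δ →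
      ρ.weight δ = 2 * δ / (1 - δ) * r * weight δ (Function.update τ v (some b)) := by
    intro ρ τ v π b r hv hr h
    -- Replacing the answer `π` by another value overwrites a variable already fixed, so it costs no
    -- weight.
    have hτ : τ v ≠ none := by simp [hr v π (by simp)]
    rw [weight_update_of_eq_none hδ hv π, h, weight_update_of_ne_none hτ, mul_assoc]
  induction h with
  | nil => simp
  | query ρ τ k y P v a π L hvP hvS hv ha h ih =>
    rw [List.length_cons, pow_succ']
    exact step hv h.refines ih
  | start ρ τ k₀ y₀ k y v j a π L ho hvS hv ha h ih =>
    rw [List.length_cons, pow_succ']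
    exact step hv h.refines ih

/-- The function opened first on a trace can be read off from the final partial assignment. -/
lemma Opens.live (hF : ∀ k x x', (∀ i ∈ S k, x i = x' i) → F k x = F k x') {j : ℕ} {v : V}
    {π : ℤˣ} (ho : Opens F ρ k y j) (hv : ρ v = none)
    (h : Trace F S idx (Function.update ρ v (some π)) k y
        (((S k).filter fun i => ρ i = none).erase v) L τ) :
    Live (F k) (Function.update τ v (some (y v))) := by
  refine ⟨_, completes_fill _ y, ?_⟩
  rw [hF k _ y]
  · exact ho.lt_one
  intro i hi
  by_cases hiv : i = v
  · subst hiv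
    simp [fill]
  rw [fill, Function.update_of_ne hiv]
  cases hρ : ρ i with
  | none =>
    rcases h.eq_none_or i (by simp [hiv, hi, hρ]) with h | h <;> simp [h]
  | some b =>
    rw [h.refines i b (by rwa [Function.update_of_ne hiv]), ho.completes i b hρ]
    rfl

/-- The overwritten value at `v` was the answer `π`, which the code records. -/
lemma eq_of_update_eq {ρ' τ' : PartialAssignment V} {v : V} {π b b' : ℤˣ}
    (hτ : Refines τ (Function.update ρ v (some π)))
    (hτ' : Refines τ' (Function.update ρ' v (some π)))
    (h : Function.update τ v (some b) = Function.update τ' v (some b')) : τ = τ' := by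
  funext i
  by_cases hi : i = v
  · subst hi
    rw [hτ i π (by simp), hτ' i π (by simp)]
  · simpa [hi] using congrFun h i

lemma eq_of_update_eq_of_none {ρ' : PartialAssignment V} {v : V} {o : Option ℤˣ}
    (hv : ρ v = none) (hv' : ρ' v = none)
    (h : Function.update ρ v o = Function.update ρ' v o) : ρ = ρ' := by
  funext i
  by_cases hi : i = v
  · subst hi
    rw [hv, hv']
  · simpa [hi] using congrFun h i

/-- A trace can be decoded: its code and its endpoint determine its starting point. -/
lemma Trace.injective (hF : ∀ k x x', (∀ i ∈ S k, x i = x' i) → F k x = F k x')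
    (hidx : ∀ k, Set.InjOn (idx k) (S k)) (h : Trace F S idx ρ k y P L τ) :
    ∀ {ρ' y' P'}, Trace F S idx ρ' k y' P' L τ → ρ = ρ' := by
  -- The second trace keeps its own `y'` and `P'`: decoding recovers the factor, but not the
  -- completion chosen for it.
  induction h with
  | nil ρ k y P hP =>
    intro ρ' y' P' h'
    cases h'
    rfl
  | query ρ τ k y P v a π L hvP hvS hv ha h ih =>
    intro ρ' y' P' h'
    generalize hT : Function.update τ v (some (y v)) = T at h'
    cases h' with
    | query _ τ' _ _ _ v' _ _ _ hvP' hvS' hv' ha' h' =>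
      obtain rfl : v = v' := hidx k hvS hvS' (ha.trans ha'.symm)
      obtain rfl := eq_of_update_eq h.refines h'.refines hT
      exact eq_of_update_eq_of_none hv hv' (ih h')
  | start ρ τ k₀ y₀ k y v j a π L ho hvS hv ha h ih =>
    intro ρ' y' P' h'
    generalize hT : Function.update τ v (some (y v)) = T at h'
    cases h' with
    | start _ τ' _ _ k' y' v' _ _ _ _ ho' hvS' hv' ha' h' =>
      have hl := ho.live hF hv h
      have hl' := ho'.live hF hv' h'
      have hc := liveBefore_eq_of_refines ho.const (refines_of_update (y v) hv h.refines)
      have hc' := liveBefore_eq_of_refines ho'.const (refines_of_update (y' v') hv' h'.refines)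
      rw [← hT] at hl' hc'
      obtain rfl : k = k' := eq_of_liveBefore_eq hl hl'
        (hc.trans (ho.count.trans (ho'.count.symm.trans hc'.symm)))
      obtain rfl : v = v' := hidx k hvS hvS' (ha.trans ha'.symm)
      obtain rfl := eq_of_update_eq h.refines h'.refines hT
      exact eq_of_update_eq_of_none hv hv' (ih h')

end Trace

/-! ### Approximating trees and existence of long traces. -/

/-- On the completions of `ρ`, some decision tree of depth at most `t` is within `γ` of `f`. -/
def Approx (f : (V → ℤˣ) → ℝ) (γ : ℝ) (ρ : PartialAssignment V) (t : ℕ) : Prop :=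
  ∃ h : DecisionTree V, h.depth ≤ t ∧ ∀ x, Completes x ρ → |h.eval x - f x| ≤ γ

lemma approx_of_leaf {f : (V → ℤˣ) → ℝ} {γ : ℝ} {ρ : PartialAssignment V} (t : ℕ) (c : ℝ)
    (h : ∀ x, Completes x ρ → |c - f x| ≤ γ) : Approx f γ ρ t :=
  ⟨.leaf c, by simp [DecisionTree.depth], by simpa [DecisionTree.eval] using h⟩

lemma approx_succ [DecidableEq V] {f : (V → ℤˣ) → ℝ} {γ : ℝ} {ρ : PartialAssignment V} {t : ℕ}
    (v : V) (h : ∀ π : ℤˣ, Approx f γ (Function.update ρ v (some π)) t) :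
    Approx f γ ρ (t + 1) := by
  obtain ⟨a, had, ha⟩ := h (-1)
  obtain ⟨b, hbd, hb⟩ := h 1
  refine ⟨.node v a b, by simp [DecisionTree.depth, had, hbd], fun x hx => ?_⟩
  simp only [DecisionTree.eval]
  rcases Int.units_eq_one_or (x v) with hv | hv
  · rw [hv, if_neg (by decide)]
    exact hb x (hv ▸ hx.update v)
  · rw [hv, if_pos rfl]
    exact ha x (hv ▸ hx.update v)

lemma approx_of_forall_constOn [Fintype ι] {F : ι → (V → ℤˣ) → ℝ} {f : (V → ℤˣ) → ℝ}
    (hf : ∀ x, f x = ∏ k, F k x) {γ : ℝ} (hγ : 0 ≤ γ) {ρ : PartialAssignment V} (t : ℕ)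
    (h : ∀ k, ConstOn (F k) ρ) : Approx f γ ρ t := by
  refine approx_of_leaf t (f (ρ.fill 1)) fun x hx => ?_
  have : f (ρ.fill 1) = f x := by
    rw [hf, hf]
    exact Finset.prod_congr rfl fun k _ => h k _ _ (completes_fill ρ 1) hx
  simpa [this] using hγ

/-- If enough functions are constantly below `1`, the product is at most `γ`. -/
lemma approx_of_le_liveBefore [Fintype ι] [LinearOrder ι] {F : ι → (V → ℤˣ) → ℝ}
    {f : (V → ℤˣ) → ℝ} (hf : ∀ x, f x = ∏ k, F k x) {η γ : ℝ} {u : ℕ} (hη0 : 0 ≤ η)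
    (hη1 : η < 1) (hu : η ^ u ≤ γ) (h0 : ∀ k x, 0 ≤ F k x) (h1 : ∀ k x, F k x ≤ 1)
    (hgap : ∀ k x, F k x < 1 → F k x ≤ η) {ρ : PartialAssignment V} (t : ℕ) {k : ι}
    (hc : ∀ k' < k, ConstOn (F k') ρ) (hk : u ≤ liveBefore F k ρ) : Approx f γ ρ t := by
  classical
  refine approx_of_leaf t 0 fun x hx => ?_
  rw [zero_sub, abs_neg, hf, abs_of_nonneg (Finset.prod_nonneg fun k _ => h0 k x)]
  refine le_trans ?_ ((pow_le_pow_of_le_one hη0 hη1.le hk).trans hu)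
  rw [liveBefore, ← Finset.prod_const, Finset.prod_filter]
  refine Finset.prod_le_prod (fun k _ => h0 k x) fun i _ => ?_
  split_ifs with hi
  · obtain ⟨hik, x', hx', hlt⟩ := hi
    exact hgap i x (hc i hik x x' hx hx' ▸ hlt)
  · exact h1 i x

/-- By `approx_succ`, whichever variable is queried, some answer leaves a restriction with no good
tree of depth one less; following such answers gives the path. -/
lemma exists_trace [DecidableEq V] [Fintype ι] [LinearOrder ι] {F : ι → (V → ℤˣ) → ℝ}
    {S : ι → Finset V} {idx : ι → V → ℕ} {u w : ℕ}
    (hF : ∀ k x x', (∀ i ∈ S k, x i = x' i) → F k x = F k x')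
    (hidx : ∀ k, ∀ v ∈ S k, idx k v < w) {f : (V → ℤˣ) → ℝ} (hf : ∀ x, f x = ∏ k, F k x)
    {η γ : ℝ} (hη0 : 0 ≤ η) (hη1 : η < 1) (hu : η ^ u ≤ γ) (h0 : ∀ k x, 0 ≤ F k x)
    (h1 : ∀ k x, F k x ≤ 1) (hgap : ∀ k x, F k x < 1 → F k x ≤ η) (t : ℕ) :
    ∀ (ρ : PartialAssignment V) (k : ι) (y : V → ℤˣ) (P : Finset V), (∀ i ∈ P, ρ i = none) →
      P ⊆ S k → ¬ Approx f γ ρ t →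
      ∃ (L : List (Option (Fin u) × Fin w × ℤˣ)) (τ : PartialAssignment V),
        L.length = t ∧ Trace F S idx ρ k y P L τ := by
  classical
  induction t with
  | zero => exact fun ρ k y P hP _ _ => ⟨[], ρ, rfl, .nil ρ k y P hP⟩
  | succ t ih =>
    have step : ∀ (ρ : PartialAssignment V) (k : ι) (y : V → ℤˣ) (P : Finset V) (v : V),
        v ∈ P → (∀ i ∈ P, ρ i = none) → P ⊆ S k → ¬ Approx f γ ρ (t + 1) →
        ∃ (π : ℤˣ) (L : List (Option (Fin u) × Fin w × ℤˣ)) (τ : PartialAssignment V),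
          L.length = t ∧ Trace F S idx (Function.update ρ v (some π)) k y (P.erase v) L τ := by
      intro ρ k y P v hvP hP hPS hna
      obtain ⟨π, hπ⟩ := not_forall.1 (mt (approx_succ v) hna)
      refine ⟨π, ih _ k y _ (fun i hi => ?_) ((Finset.erase_subset _ _).trans hPS) hπ⟩
      rw [Function.update_of_ne (Finset.ne_of_mem_erase hi)]
      exact hP i (Finset.mem_of_mem_erase hi)
    intro ρ k₀ y₀ P hP hPS hna
    rcases P.eq_empty_or_nonempty with rfl | ⟨v, hv⟩
    · have hne : (Finset.univ.filter fun k => ¬ ConstOn (F k) ρ).Nonempty := by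
        by_contra hemp
        refine hna (approx_of_forall_constOn hf ((pow_nonneg hη0 u).trans hu) _ fun k => ?_)
        by_contra hk
        exact hemp ⟨k, by simp [hk]⟩
      obtain ⟨k, hk, hmin⟩ := Finset.exists_min_image _ id hne
      have hknc : ¬ ConstOn (F k) ρ := (Finset.mem_filter.1 hk).2
      have hc : ∀ k' < k, ConstOn (F k') ρ := by
        intro k' hlt
        by_contra hk'
        exact absurd (hmin k' (by simp [hk'])) (not_le.2 hlt)
      have hj : liveBefore F k ρ < u := by
        by_contra hj
        exact hna (approx_of_le_liveBefore hf hη0 hη1 hu h0 h1 hgap _ hc (not_lt.1 hj))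
      -- A factor that is not live is constantly 1, since it is bounded by 1.
      obtain ⟨y, hy, hylt⟩ : Live (F k) ρ := by
        by_contra hl
        refine hknc fun x x' hx hx' => ?_
        have key : ∀ x, Completes x ρ → F k x = 1 := fun x hx =>
          le_antisymm (h1 k x) (not_lt.1 fun hlt => hl ⟨x, hx, hlt⟩)
        rw [key x hx, key x' hx']
      obtain ⟨v, hv⟩ : ((S k).filter fun i => ρ i = none).Nonempty := by
        by_contra hemp
        refine hknc fun x x' hx hx' => hF k x x' fun i hi => ?_
        cases hρ : ρ i with
        | none => exact absurd ⟨i, by simp [hi, hρ]⟩ hemp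
        | some b => rw [hx i b hρ, hx' i b hρ]
      have hvS := (Finset.mem_filter.1 hv).1
      obtain ⟨π, L, τ, hL, hT⟩ := step ρ k y _ v hv (fun i hi => (Finset.mem_filter.1 hi).2)
        (Finset.filter_subset _ _) hna
      exact ⟨(some ⟨_, hj⟩, ⟨_, hidx k v hvS⟩, π) :: L, _, by simp [hL],
        .start ρ τ k₀ y₀ k y v _ _ π L ⟨hc, hy, hylt, rfl⟩ hvS (Finset.mem_filter.1 hv).2 rfl hT⟩
    · obtain ⟨π, L, τ, hL, hT⟩ := step ρ k₀ y₀ P v hv hP hPS hna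
      exact ⟨(none, ⟨_, hidx k₀ v (hPS hv)⟩, π) :: L, _, by simp [hL],
        .query ρ τ k₀ y₀ P v _ π L hv (hPS hv) (hP v hv) rfl hT⟩

/-! ### Counting codes. -/

open Classical in
/-- The partial assignments from which a trace with a given code starts have small weight. -/
lemma sum_weight_trace_le [Fintype V] [DecidableEq V] [Fintype ι] [LinearOrder ι] {F : ι → (V → ℤˣ) → ℝ}
    {S : ι → Finset V} {idx : ι → V → ℕ} {u w : ℕ}
    (hF : ∀ k x x', (∀ i ∈ S k, x i = x' i) → F k x = F k x')
    (hidx : ∀ k, Set.InjOn (idx k) (S k)) {δ : ℝ} (hδ0 : 0 ≤ δ) (hδ1 : δ < 1) (k : ι)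
    (y : V → ℤˣ) (P : Finset V) (L : List (Option (Fin u) × Fin w × ℤˣ)) :
    ∑ ρ : PartialAssignment V with ∃ τ, Trace F S idx ρ k y P L τ, ρ.weight δ ≤
      (2 * δ / (1 - δ)) ^ L.length := by
  have hq : 0 ≤ 2 * δ / (1 - δ) := div_nonneg (by linarith) (by linarith)
  have hex : ∀ ρ : PartialAssignment V, ∃ τ : PartialAssignment V,
      (∃ τ, Trace F S idx ρ k y P L τ) → Trace F S idx ρ k y P L τ := fun ρ => by
    by_cases h : ∃ τ, Trace F S idx ρ k y P L τ
    · exact ⟨h.choose, fun _ => h.choose_spec⟩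
    · exact ⟨ρ, fun h' => absurd h' h⟩
  -- A code does not determine the endpoint, so one endpoint is chosen per `ρ`; the default `ρ` is
  -- never used.
  choose enc henc using hex
  have hinj : Set.InjOn enc
      (Finset.univ.filter fun ρ => ∃ τ, Trace F S idx ρ k y P L τ :
        Finset (PartialAssignment V)) := by
    intro ρ hρ ρ' hρ' h
    have t1 := henc ρ (by simpa using hρ)
    have t2 := henc ρ' (by simpa using hρ')
    exact t1.injective hF hidx (h ▸ t2)
  calc ∑ ρ : PartialAssignment V with ∃ τ, Trace F S idx ρ k y P L τ, ρ.weight δ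
      = ∑ ρ : PartialAssignment V with ∃ τ, Trace F S idx ρ k y P L τ,
          (2 * δ / (1 - δ)) ^ L.length * (enc ρ).weight δ :=
        Finset.sum_congr rfl fun ρ hρ =>
          (henc ρ (Finset.mem_filter.1 hρ).2).weight_eq hδ1
    _ = (2 * δ / (1 - δ)) ^ L.length * ∑ τ ∈ (Finset.univ.filter fun ρ =>
          ∃ τ, Trace F S idx ρ k y P L τ).image enc, τ.weight δ := by
        rw [← Finset.mul_sum, Finset.sum_image hinj]
    _ ≤ (2 * δ / (1 - δ)) ^ L.length * 1 := by
        refine mul_le_mul_of_nonneg_left ?_ (pow_nonneg hq _)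
        rw [← sum_weight (V := V) δ]
        exact Finset.sum_le_univ_sum_of_nonneg fun τ => weight_nonneg hδ0 hδ1.le τ
    _ = _ := mul_one _

open Classical in
/-- The switching lemma for partial assignments. -/
lemma sum_weight_not_approx_le [Fintype V] [DecidableEq V] [Fintype ι] [LinearOrder ι]
    {F : ι → (V → ℤˣ) → ℝ} {S : ι → Finset V} {u w : ℕ} (hS : ∀ k, (S k).card ≤ w)
    (hF : ∀ k x x', (∀ i ∈ S k, x i = x' i) → F k x = F k x')
    {f : (V → ℤˣ) → ℝ} (hf : ∀ x, f x = ∏ k, F k x) {η γ δ : ℝ} (hη0 : 0 ≤ η) (hη1 : η < 1)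
    (hu1 : 1 ≤ u) (hu : η ^ u ≤ γ) (h0 : ∀ k x, 0 ≤ F k x) (h1 : ∀ k x, F k x ≤ 1)
    (hgap : ∀ k x, F k x < 1 → F k x ≤ η) (hδ0 : 0 ≤ δ) (hδ1 : δ < 1) {t : ℕ} (ht : 1 ≤ t) :
    ∑ ρ : PartialAssignment V with ¬ Approx f γ ρ t, ρ.weight δ ≤
      1 / 2 * (δ / (1 - δ) * (8 * u * w)) ^ t := by
  obtain ⟨s, rfl⟩ : ∃ s, t = s + 1 := ⟨t - 1, by omega⟩
  have hq : 0 ≤ 2 * δ / (1 - δ) := div_nonneg (by linarith) (by linarith)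
  rcases isEmpty_or_nonempty ι with hι | ⟨⟨k₀⟩⟩
  · rw [Finset.sum_eq_zero]
    · have : 0 ≤ δ / (1 - δ) := div_nonneg hδ0 (by linarith)
      positivity
    · intro ρ hρ
      exact absurd (approx_of_forall_constOn hf ((pow_nonneg hη0 u).trans hu) _ fun k =>
        hι.elim k) (Finset.mem_filter.1 hρ).2
  let idx : ι → V → ℕ := fun k v => if h : v ∈ S k then ((S k).equivFin ⟨v, h⟩ : ℕ) else 0
  have hidx : ∀ k, Set.InjOn (idx k) (S k) := by
    intro k v hv v' hv' h
    simp only [Finset.mem_coe] at hv hv'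
    simp only [idx, dif_pos hv, dif_pos hv'] at h
    simpa using (S k).equivFin.injective (Fin.ext h)
  have hidxw : ∀ k, ∀ v ∈ S k, idx k v < w := by
    intro k v hv
    simp only [idx, dif_pos hv]
    exact (Fin.is_lt _).trans_le (hS k)
  -- With no pending variables the first query must open a factor, so its entry has `u` choices
  -- rather than `u + 1`. This is the source of the factor `1 / 2`.
  let codes := (Fin u × Fin w × ℤˣ) × List.Vector (Option (Fin u) × Fin w × ℤˣ) s
  let toList : codes → List (Option (Fin u) × Fin w × ℤˣ) := fun c =>
    (some c.1.1, c.1.2) :: c.2.toList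
  have hcover : ∀ ρ : PartialAssignment V, ¬ Approx f γ ρ (s + 1) →
      ∃ c : codes, ∃ τ, Trace F S idx ρ k₀ 1 ∅ (toList c) τ := by
    -- With `P = ∅` the initial `k₀` and completion `1` are only placeholders.
    intro ρ hρ
    obtain ⟨L, τ, hL, hT⟩ := exists_trace (idx := idx) hF hidxw hf hη0 hη1 hu h0 h1 hgap (s + 1)
      ρ k₀ 1 ∅ (by simp) (by simp) hρ
    cases hT with
    | nil => simp at hL
    | query _ _ _ _ _ v a π L hvP => simp at hvP
    | start _ τ _ _ k y v j a π L ho hvS hv ha h =>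
      exact ⟨((j, a, π), ⟨L, by simpa using hL⟩), _,
        .start ρ τ k₀ 1 k y v j a π L ho hvS hv ha h⟩
  have hcard : (Fintype.card codes : ℝ) = (u * (w * 2)) * ((u + 1) * (w * 2)) ^ s := by
    simp [codes, card_vector]
  have hu1' : (1 : ℝ) ≤ u := by exact_mod_cast hu1
  calc ∑ ρ : PartialAssignment V with ¬ Approx f γ ρ (s + 1), ρ.weight δ
      ≤ ∑ c : codes, ∑ ρ : PartialAssignment V with
          ∃ τ, Trace F S idx ρ k₀ 1 ∅ (toList c) τ, ρ.weight δ := by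
        simp only [Finset.sum_filter]
        rw [Finset.sum_comm]
        refine Finset.sum_le_sum fun ρ _ => ?_
        have hw := weight_nonneg hδ0 hδ1.le ρ
        have hite : ∀ c : codes, 0 ≤ if ∃ τ, Trace F S idx ρ k₀ 1 ∅ (toList c) τ
            then ρ.weight δ else 0 := fun c => by split_ifs <;> simp [hw]
        by_cases hρ : Approx f γ ρ (s + 1)
        · rw [if_neg (not_not.2 hρ)]
          exact Finset.sum_nonneg fun c _ => hite c
        · obtain ⟨c, hc⟩ := hcover ρ hρ
          rw [if_pos hρ]
          exact (if_pos hc).ge.trans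
            (Finset.single_le_sum (fun c _ => hite c) (Finset.mem_univ c))
    _ ≤ ∑ _c : codes, (2 * δ / (1 - δ)) ^ (s + 1) := by
        refine Finset.sum_le_sum fun c _ => ?_
        have := sum_weight_trace_le hF hidx hδ0 hδ1 k₀ 1 ∅ (toList c)
        simpa [toList] using this
    _ = ((u * (w * 2)) * ((u + 1) * (w * 2)) ^ s) * (2 * δ / (1 - δ)) ^ (s + 1) := by
        rw [Finset.sum_const, nsmul_eq_mul, Finset.card_univ, hcard]
    _ ≤ ((u * (w * 2)) * (4 * u * w) ^ s) * (2 * δ / (1 - δ)) ^ (s + 1) := by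
        -- Uses `u + 1 ≤ 2 * u`, that is, `1 ≤ u`.
        have : ((u : ℝ) + 1) * (w * 2) ≤ 4 * u * w := by
          nlinarith [(Nat.cast_nonneg w : (0 : ℝ) ≤ w)]
        gcongr
    _ = 1 / 2 * (δ / (1 - δ) * (8 * u * w)) ^ (s + 1) := by
        rw [show δ / (1 - δ) * (8 * u * w) = (4 * u * w) * (2 * δ / (1 - δ)) by ring,
          mul_pow (4 * (u : ℝ) * w), pow_succ (4 * (u : ℝ) * w)]
        ring

end Switching

/-! ### Transfer to random restrictions. -/

/-- The partial assignment that a restriction represents. -/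
def Restriction.toPartial {n : ℕ} (ρ : Restriction n) : PartialAssignment (Fin n) :=
  fun i => if h : i ∈ ρ.1 then none else some (ρ.2 ⟨i, h⟩)

lemma Restriction.toPartial_eq_none {n : ℕ} {ρ : Restriction n} {i : Fin n} :
    ρ.toPartial i = none ↔ i ∈ ρ.1 := by
  unfold toPartial
  split_ifs with h <;> simp [h]

lemma Restriction.toPartial_injective {n : ℕ} :
    Function.Injective (Restriction.toPartial (n := n)) := by
  rintro ⟨J, z⟩ ⟨J', z'⟩ h
  obtain rfl : J = J' := by
    ext i
    have := congrFun h i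
    rw [← toPartial_eq_none (ρ := ⟨J, z⟩), this, toPartial_eq_none]
  congr 1
  funext ⟨i, hi⟩
  simpa [toPartial, hi] using congrFun h i

lemma Restriction.weight_toPartial {n : ℕ} (δ : ℝ) (ρ : Restriction n) :
    ρ.toPartial.weight δ = δ ^ ρ.1.card * ((1 - δ) / 2) ^ (n - ρ.1.card) := by
  simp only [PartialAssignment.weight, toPartial_eq_none]
  rw [Finset.prod_ite, Finset.prod_const, Finset.prod_const, Finset.filter_not,
    Finset.filter_univ_mem, Finset.card_sdiff_of_subset (Finset.subset_univ _), Finset.card_univ,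
    Fintype.card_fin]

lemma randomRestriction_apply {n : ℕ} {δ : ℝ} (h0 : 0 ≤ δ) (h1 : δ ≤ 1) (ρ : Restriction n) :
    (randomRestriction n δ h0 h1 ρ).toReal = ρ.toPartial.weight δ := by
  classical
  obtain ⟨J, z⟩ := ρ
  have hmap : ∀ J', ((PMF.uniformOfFintype ({i : Fin n // i ∉ J'} → ℤˣ)).map
      (fun z => (⟨J', z⟩ : Restriction n))) ⟨J, z⟩ =
      if J' = J then ((2 : ENNReal) ^ (n - J.card))⁻¹ else 0 := by
    intro J'
    rw [PMF.map_apply, tsum_fintype]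
    split_ifs with hJ
    · subst hJ
      rw [Finset.sum_eq_single z]
      · simp
      · intro b _ hb
        rw [if_neg]
        intro h
        exact hb (by simpa using h.symm)
      · simp
    · refine Finset.sum_eq_zero fun b _ => if_neg fun h => hJ ?_
      exact (congrArg Sigma.fst h).symm
  rw [Restriction.weight_toPartial, randomRestriction, PMF.bind_apply, tsum_fintype]
  simp only [hmap, mul_ite, mul_zero, Finset.sum_ite_eq', Finset.mem_univ, if_true]
  simp only [randomSubset, PMF.ofFintype_apply, ENNReal.toReal_mul, ENNReal.toReal_pow,
    ENNReal.toReal_inv, ENNReal.toReal_ofReal h0, ENNReal.toReal_ofReal (sub_nonneg.2 h1),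
    ENNReal.toReal_ofNat]
  rw [div_pow]
  ring

namespace DecisionTree

/-- Simplify a decision tree by the values that a restriction fixes. -/
def restrictTo {n : ℕ} (ρ : Restriction n) :
    DecisionTree (Fin n) → DecisionTree {i : Fin n // i ∈ ρ.1}
  | leaf c => leaf c
  | node v a b =>
    if h : v ∈ ρ.1 then node ⟨v, h⟩ (a.restrictTo ρ) (b.restrictTo ρ)
    else if ρ.2 ⟨v, h⟩ = -1 then a.restrictTo ρ else b.restrictTo ρ

lemma depth_restrictTo_le {n : ℕ} (ρ : Restriction n) (h : DecisionTree (Fin n)) :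
    (h.restrictTo ρ).depth ≤ h.depth := by
  induction h with
  | leaf c => simp [restrictTo, depth]
  | node v a b iha ihb =>
    simp only [restrictTo]
    split_ifs <;> simp only [depth] <;> omega

lemma eval_restrictTo {n : ℕ} (ρ : Restriction n) (h : DecisionTree (Fin n)) :
    (h.restrictTo ρ).eval = restrict h.eval ρ := by
  funext y
  induction h with
  | leaf c => rfl
  | node v a b iha ihb =>
    simp only [restrict] at iha ihb ⊢
    by_cases hv : v ∈ ρ.1
    · simp [restrictTo, eval, hv, iha, ihb]
    · by_cases hz : ρ.2 ⟨v, hv⟩ = -1 <;> simp [restrictTo, eval, hv, hz, iha, ihb]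

end DecisionTree

lemma exists_decisionTree_of_approx {n t : ℕ} {f : (Fin n → ℤˣ) → ℝ} {γ : ℝ} (hγ : 0 ≤ γ)
    {ρ : Restriction n} (h : Switching.Approx f γ ρ.toPartial t) :
    ∃ h : DecisionTree {i : Fin n // i ∈ ρ.1}, h.depth ≤ t ∧ ‖h.eval - restrict f ρ‖ ≤ γ := by
  obtain ⟨h, hd, happ⟩ := h
  refine ⟨h.restrictTo ρ, (h.depth_restrictTo_le ρ).trans hd, ?_⟩
  rw [pi_norm_le_iff_of_nonneg hγ]
  intro y
  rw [Pi.sub_apply, DecisionTree.eval_restrictTo, Real.norm_eq_abs]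
  refine happ _ fun i b hb => ?_
  by_cases hi : i ∈ ρ.1
  · simp [Restriction.toPartial, hi] at hb
  · simpa [Restriction.toPartial, hi] using hb

/-- The ceiling alone gives the bound; the extra 1 in `switchingU` serves to make `1 ≤ u`. -/
lemma pow_switchingU_le {η γ : ℝ} (hη0 : 0 ≤ η) (hη1 : η < 1) (hγ0 : 0 ≤ γ)
    (hγ : 0 < η → 0 < γ) : η ^ switchingU η γ ≤ γ := by
  unfold switchingU
  split_ifs with h
  · simpa [h] using hγ0
  · have hη : 0 < η := lt_of_le_of_ne hη0 (Ne.symm h)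
    calc η ^ (⌈Real.logb η γ⌉₊ + 1) ≤ η ^ ⌈Real.logb η γ⌉₊ :=
          pow_le_pow_of_le_one hη0 hη1.le (Nat.le_succ _)
      _ = η ^ (⌈Real.logb η γ⌉₊ : ℝ) := (Real.rpow_natCast _ _).symm
      _ ≤ η ^ Real.logb η γ := Real.rpow_le_rpow_of_exponent_ge hη hη1.le (Nat.le_ceil _)
      _ = γ := Real.rpow_logb hη hη1.ne (hγ hη)

lemma one_le_switchingU (η γ : ℝ) : 1 ≤ switchingU η γ := by
  unfold switchingU
  split_ifs <;> omega

theorem lemma1 (n m w t : ℕ) (ht : 1 ≤ t)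
    (η γ δ : ℝ) (hη0 : 0 ≤ η) (hη1 : η < 1)
    (hγ0 : 0 ≤ γ) (hγ : 0 < η → 0 < γ)
    (hδ0 : 0 ≤ δ) (hδ1 : δ < 1)
    (S : Fin m → Finset (Fin n)) (hS : ∀ k, (S k).card ≤ w)
    (g : (k : Fin m) → ({i : Fin n // i ∈ S k} → ℤˣ) → ℝ)
    (hg : ∀ k, IsContractive η (g k))
    (f : (Fin n → ℤˣ) → ℝ) (hf : ∀ x, f x = ∏ k, g k (fun i => x i)) :
    1 - 1 / 2 * (δ / (1 - δ) * (8 * (switchingU η γ : ℝ) * (w : ℝ))) ^ t ≤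
      ((randomRestriction n δ hδ0 hδ1.le).toOuterMeasure
        {ρ | ∃ h : DecisionTree {i : Fin n // i ∈ ρ.1},
          h.depth ≤ t ∧ ‖h.eval - restrict f ρ‖ ≤ γ}).toReal := by
  
  classical
  set A : Set (Restriction n) := {ρ | ∃ h : DecisionTree {i : Fin n // i ∈ ρ.1},
    h.depth ≤ t ∧ ‖h.eval - restrict f ρ‖ ≤ γ}
  set p := randomRestriction n δ hδ0 hδ1.le
  have hbad := Switching.sum_weight_not_approx_le (V := Fin n) (ι := Fin m)
    (F := fun k x => g k fun i => x i) (S := S) hS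
    (fun k x x' hx => congrArg (g k) (funext fun i => hx i i.2)) hf hη0 hη1
    (one_le_switchingU η γ) (pow_switchingU_le hη0 hη1 hγ0 hγ) (fun k x => (hg k).1 _)
    (fun k x => (hg k).2.1 _) (fun k x => (hg k).2.2.2 _) hδ0 hδ1 ht
  -- Only an inequality is needed: restrictions in `Aᶜ` embed, with equal weight, among the bad
  -- partial assignments.
  have hAc : (p.toOuterMeasure Aᶜ).toReal ≤
      ∑ r : PartialAssignment (Fin n) with ¬ Switching.Approx f γ r t, r.weight δ := by
    rw [PMF.toOuterMeasure_apply_fintype, ENNReal.toReal_sum fun ρ _ =>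
      ne_top_of_le_ne_top (p.apply_ne_top ρ) (Set.indicator_le_self _ _ _)]
    calc ∑ ρ, (Aᶜ.indicator p ρ).toReal
        = ∑ ρ with ρ ∈ Aᶜ, ρ.toPartial.weight δ := by
          rw [Finset.sum_filter]
          refine Finset.sum_congr rfl fun ρ _ => ?_
          rw [Set.indicator_apply]
          split_ifs
          · exact randomRestriction_apply hδ0 hδ1.le ρ
          · simp
      _ = ∑ r ∈ (Finset.univ.filter (· ∈ Aᶜ)).image Restriction.toPartial, r.weight δ :=
          (Finset.sum_image Restriction.toPartial_injective.injOn).symm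
      _ ≤ _ := by
          refine Finset.sum_le_sum_of_subset_of_nonneg (fun r hr => ?_) fun r _ _ =>
            PartialAssignment.weight_nonneg hδ0 hδ1.le r
          obtain ⟨ρ, hρ, rfl⟩ := Finset.mem_image.1 hr
          exact Finset.mem_filter.2 ⟨Finset.mem_univ _, fun h =>
            (Finset.mem_filter.1 hρ).2 (exists_decisionTree_of_approx hγ0 h)⟩
  have hle : (1 : ENNReal) ≤ p.toOuterMeasure A + p.toOuterMeasure Aᶜ := by
    rw [← (p.toOuterMeasure_apply_eq_one_iff Set.univ).2 (Set.subset_univ _),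
      ← Set.union_compl_self A]
    exact MeasureTheory.measure_union_le _ _
  have hfin : ∀ B : Set (Restriction n), p.toOuterMeasure B ≠ ⊤ := fun B =>
    ne_top_of_le_ne_top ENNReal.one_ne_top
      (((p.toOuterMeasure_apply_eq_one_iff Set.univ).2 (Set.subset_univ _)) ▸
        MeasureTheory.measure_mono (Set.subset_univ B))
  have hreal := ENNReal.toReal_mono (ENNReal.add_ne_top.2 ⟨hfin A, hfin Aᶜ⟩) hle
  rw [ENNReal.toReal_one, ENNReal.toReal_add (hfin A) (hfin Aᶜ)] at hreal
  linarith
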